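/- **Setting.** Consider a finite extensive-form game (without chance moves) with perfect recall: $H$ is a finite prefix-closed set of histories (finite sequences of actions, containing the empty one), the non-terminal histories are partitioned into information sets $I\in\mathcal I$, and at all histories of $I$ the same player acts and the same set $A(I)$ of actions is available. Without loss of generality each action can be played in exactly one information set (tag every action with its information set). An assessment $(\beta,\mu)$ assigns to every $I\in\mathcal I$ a probability distribution $\beta(I)$ on $A(I)$ and a probability distribution $\mu(I)$ on the histories in $I$. Let $P_\beta(h)$ be the product of the probabilities of the actions along $h$, and $P_\beta(I)=\sum_{h\in I}P_\beta(h)$. The assessment $(\beta,\mu)$ is *consistent* if there are assessments $(\beta^n,\mu^n)\to(\beta,\mu)$ with $P_{\beta^n}(h)>0$ for all $h\in H$ and $\mu^n(I)(h)=P_{\beta^n}(h)/P_{\beta^n}(I)$ for all $I\in\mathcal I$, $h\in I$. **The linear system.** Let $a_1,\dots,a_{N_a}$ be all actions of the game, let $(h^1_i,h^2_i)$, $1\le i\le N_p$, be all ordered pairs of histories lying in a common information set, and let $M=N_p+N_a$. Let $A\in\mathbb R^{M\times N_a}$ be the matrix whose last $N_a$ rows form the identity matrix and whose entry for $i\le N_p$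 is $A_{ij}=1$ if $a_j$ is on the path $h^1_i$ but not on $h^2_i$, $A_{ij}=-1$ if $a_j$ is on $h^2_i$ but not on $h^1_i$, and $A_{ij}=0$ otherwise. Given $(\beta,\mu)$, put $b_i=\log\alpha_i-\log\gamma_i$ with $\log 0=-\infty$, where $\alpha_i=\mu(h^1_i)$, $\gamma_i=\mu(h^2_i)$ for $i\le N_p$, and $\alpha_{N_p+j}=\beta(a_j)$, $\gamma_{N_p+j}=1$; the entry $b_i$ is ill-defined if $\alpha_i=\gamma_i=0$. **Extreme directions.** For $c\in\{-\infty,0,\infty\}^M$ let $$C^A_c=\{p\in\mathbb R^M : pA=0,\ p_i\ge 0 \text{ if } c_i=\infty,\ p_i\le 0\text{ if } c_i=-\infty\},$$ let $ED(C^A_c)$ be any chosen finite set of integer vectors whose conical combinations (with coefficients $\ge 0$) are exactly the elements of $C^A_c$, and let $\mathcal E^A=\bigcup_{c\in\{-\infty,0,\infty\}^M}ED(C^A_c)$. For $p\in\mathbb R^M$ consider the property $$(\ast)\qquad \sum_{p_i\ne0}p_ib_i=0\quad\text{or}\quad \sum_{p_i\neq 0}p_ib_i\ \text{ is ill-defined},$$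 where the sum is ill-defined if some $b_i$ with $p_i\neq0$ is ill-defined or if the sum contains both a term $+\infty$ and a term $-\infty$. **Proposition (General Consistency Test).** An assessment $(\beta,\mu)$ is consistent if and only if $(\ast)$ holds for all $p\in\mathcal E^A$. The same equivalence holds if the rows $i$ with ill-defined $b_i$ are first omitted from the system $Ax=b$ and $\mathcal E^A$ is formed, with any choice of extreme directions, from the reduced matrix. -/

import Mathlib

/-! ### Extensive-form games -/

/-- A finite extensive-form game with players `N` and action labels `Act`. A history is the list of
the actions played so far, and the root is the empty list. The partition of the non-terminal
histories into information sets is given by a labelling `info` with labels in `L`: two non-terminal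
histories lie in the same information set iff they have the same label. The values of `info` and
`player` matter at non-terminal histories only, those of `utility` at terminal ones only. -/
structure ExtensiveGame (N L Act : Type*) where
  histories : Finset (List Act)
  nil_mem : [] ∈ histories
  prefix_mem : ∀ h ∈ histories, ∀ g : List Act, g <+: h → g ∈ histories
  info : List Act → L
  player : List Act → N
  utility : N → List Act → ℝ
  /-- The acting player is the same at all histories of an information set. -/
  player_eq : ∀ h g : List Act, (∃ a, h ++ [a] ∈ histories) → (∃ a, g ++ [a] ∈ histories) →
    info h = info g → player h = player g
  /-- The available actions are the same at all histories of an information set. -/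
  actions_eq : ∀ h g : List Act, (∃ a, h ++ [a] ∈ histories) → (∃ a, g ++ [a] ∈ histories) →
    info h = info g → ∀ a, h ++ [a] ∈ histories ↔ g ++ [a] ∈ histories

namespace ExtensiveGame

variable {N L Act : Type*} (G : ExtensiveGame N L Act)

open Classical in
/-- The non-terminal histories. -/
noncomputable def nonterminal : Finset (List Act) :=
  G.histories.filter fun h => ∃ a, h ++ [a] ∈ G.histories

open Classical in
/-- The (labels of the) information sets. -/
noncomputable def infoSets : Finset L :=
  G.nonterminal.image G.info

open Classical in
/-- The set of the histories that belong to the information set labelled `I`. -/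
noncomputable def historiesOf (I : L) : Finset (List Act) :=
  G.nonterminal.filter fun h => G.info h = I

open Classical in
/-- The set `A(I)` of the actions that are available at the information set labelled `I`. -/
noncomputable def actions (I : L) : Finset Act :=
  (G.histories.biUnion fun h => h.toFinset).filter fun a =>
    ∃ h ∈ G.historiesOf I, h ++ [a] ∈ G.histories

/-- The sequence of the (information set, action) pairs along a history. -/
def path (h : List Act) : List (L × Act) :=
  (List.finRange h.length).map fun k : Fin h.length => (G.info (h.take k), h.get k)

open Classical in
/-- The sequence of the information sets encountered and actions played by player `i` along `h`. -/
noncomputable def experience (i : N) (h : List Act) : List (L × Act) :=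
  ((List.finRange h.length).filter fun k : Fin h.length => G.player (h.take k) = i).map
    fun k : Fin h.length => (G.info (h.take k), h.get k)

/-- Perfect recall: at any two histories of one information set, the acting player has encountered
the same information sets and played the same actions, in the same order. -/
def PerfectRecall : Prop :=
  ∀ h ∈ G.nonterminal, ∀ g ∈ G.nonterminal, G.info h = G.info g →
    G.experience (G.player h) h = G.experience (G.player h) g

/-! ### Assessments and consistency -/

/-- An assessment `(β, μ)`: a behavioural strategy profile `β`, which gives a probability
distribution over `A(I)` for each information set `I`, and a system of beliefs `μ`, which gives a
probability distribution over the histories of each information set. (The values of `strategy` and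
`belief` at other arguments are never used.) -/
structure Assessment where
  strategy : L → Act → ℝ
  belief : L → List Act → ℝ
  strategy_nonneg : ∀ I ∈ G.infoSets, ∀ a ∈ G.actions I, 0 ≤ strategy I a
  strategy_sum : ∀ I ∈ G.infoSets, ∑ a ∈ G.actions I, strategy I a = 1
  belief_nonneg : ∀ I ∈ G.infoSets, ∀ h ∈ G.historiesOf I, 0 ≤ belief I h
  belief_sum : ∀ I ∈ G.infoSets, ∑ h ∈ G.historiesOf I, belief I h = 1

variable {G}

/-- The probability `P_β(h)` of reaching the history `h`. -/
def Assessment.prob (s : G.Assessment) (h : List Act) : ℝ :=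
  ((G.path h).map fun x => s.strategy x.1 x.2).prod

/-- The probability `P_β(I)` of reaching the information set `I`. -/
noncomputable def Assessment.probInfo (s : G.Assessment) (I : L) : ℝ :=
  ∑ h ∈ G.historiesOf I, s.prob h

/-- An assessment is consistent if it is the limit of assessments that reach every history with
positive probability and whose beliefs are given by Bayes' rule. -/
def Assessment.Consistent (s : G.Assessment) : Prop :=
  ∃ t : ℕ → G.Assessment,
    (∀ I ∈ G.infoSets, ∀ a ∈ G.actions I,
      Filter.Tendsto (fun n => (t n).strategy I a) Filter.atTop (nhds (s.strategy I a))) ∧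
    (∀ I ∈ G.infoSets, ∀ h ∈ G.historiesOf I,
      Filter.Tendsto (fun n => (t n).belief I h) Filter.atTop (nhds (s.belief I h))) ∧
    ∀ n, (∀ h ∈ G.histories, 0 < (t n).prob h) ∧
      ∀ I ∈ G.infoSets, ∀ h ∈ G.historiesOf I,
        (t n).belief I h = (t n).prob h / (t n).probInfo I

/-! ### The linear system of an assessment -/

variable (G)

open Classical in
/-- The set of all actions of the game. An action is tagged with the information set at which it is
played, so that each action can be played in exactly one information set. -/
noncomputable def actionSet : Finset (L × Act) :=
  (G.infoSets ×ˢ G.histories.biUnion fun h => h.toFinset).filter fun x => x.2 ∈ G.actions x.1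

open Classical in
/-- The set of all ordered pairs of histories that lie in the same information set. -/
noncomputable def pairSet : Finset (List Act × List Act) :=
  (G.nonterminal ×ˢ G.nonterminal).filter fun q => G.info q.1 = G.info q.2

/-- The index type of the columns: one column for each action. -/
abbrev Col : Type _ := {x : L × Act // x ∈ G.actionSet}

/-- The index type of the rows: one row for each pair of histories in the same information set,
followed by one row for each action. -/
abbrev Row : Type _ := {q : List Act × List Act // q ∈ G.pairSet} ⊕ G.Col

open Classical in
/-- The upper block `Ã` of the matrix. -/
noncomputable def pairMatrix : Matrix {q : List Act × List Act // q ∈ G.pairSet} G.Col ℝ :=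
  fun q x =>
    if x.1 ∈ G.path q.1.1 ∧ x.1 ∉ G.path q.1.2 then 1
    else if x.1 ∉ G.path q.1.1 ∧ x.1 ∈ G.path q.1.2 then -1
    else 0

open Classical in
/-- The matrix `A`: the block `Ã` on top of the identity matrix. -/
noncomputable def systemMatrix : Matrix G.Row G.Col ℝ :=
  Matrix.fromRows G.pairMatrix 1

variable {G}

/-- The vector `α`. -/
def Assessment.alpha (s : G.Assessment) : G.Row → ℝ :=
  Sum.elim (fun q => s.belief (G.info q.1.1) q.1.1) (fun x => s.strategy x.1.1 x.1.2)

/-- The vector `γ`. -/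
def Assessment.gamma (s : G.Assessment) : G.Row → ℝ :=
  Sum.elim (fun q => s.belief (G.info q.1.2) q.1.2) (fun _ => 1)

open Classical in
/-- The right-hand side `b = log α - log γ`, with `log 0 = -∞`; the value `none` stands for an
ill-defined entry (`α i = γ i = 0`). -/
noncomputable def Assessment.rhs (s : G.Assessment) (i : G.Row) : Option EReal :=
  if s.alpha i = 0 ∧ s.gamma i = 0 then none
  else some (ENNReal.log (ENNReal.ofReal (s.alpha i)) - ENNReal.log (ENNReal.ofReal (s.gamma i)))

open Classical in
/-- The rows in which the right-hand side is well-defined. -/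
noncomputable def Assessment.wellDefinedRows (s : G.Assessment) : Finset G.Row :=
  Finset.univ.filter fun i => s.rhs i ≠ none

/-- The index type of the rows of the reduced system, from which the equations with an ill-defined
right-hand side are omitted. -/
abbrev Assessment.ReducedRow (s : G.Assessment) : Type _ := {i : G.Row // i ∈ s.wellDefinedRows}

/-- The matrix of the reduced system. -/
noncomputable def Assessment.reducedMatrix (s : G.Assessment) : Matrix s.ReducedRow G.Col ℝ :=
  G.systemMatrix.submatrix Subtype.val id

/-- The right-hand side of the reduced system. -/
noncomputable def Assessment.reducedRhs (s : G.Assessment) (i : s.ReducedRow) : Option EReal :=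
  s.rhs i.1

end ExtensiveGame

/-! ### Cones, extreme directions and the property to be tested -/

/-- The cone `C^A_b` of all `p` with `p A = 0`, with `p i ≥ 0` where `b i = ∞` and with `p i ≤ 0`
where `b i = -∞`. -/
def signCone {R C : Type*} [Fintype R] (A : Matrix R C ℝ) (b : R → EReal) : Set (R → ℝ) :=
  {p | Matrix.vecMul p A = 0 ∧ (∀ i, b i = ⊤ → 0 ≤ p i) ∧ (∀ i, b i = ⊥ → p i ≤ 0)}

/-- `S` is a finite set of integer vectors whose conical combinations are exactly the elements of
the cone `K`. -/
def IsIntegralConicalBasis {R : Type*} (S : Finset (R → ℝ)) (K : Set (R → ℝ)) : Prop :=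
  (∀ e ∈ S, ∀ i, ∃ k : ℤ, e i = k) ∧
    K = {p | ∃ c : (R → ℝ) → ℝ, (∀ e ∈ S, 0 ≤ c e) ∧ p = ∑ e ∈ S, c e • e}

/-- The sign patterns: the vectors with entries in `{-∞, 0, ∞}`. -/
def signPatterns (R : Type*) : Set (R → EReal) :=
  {b | ∀ i, b i = ⊥ ∨ b i = 0 ∨ b i = ⊤}

/-- `ED` chooses a set of extreme directions for each of the cones `C^A_b`, where `b` ranges over
the sign patterns. -/
def IsExtremeDirectionChoice {R C : Type*} [Fintype R] (A : Matrix R C ℝ)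
    (ED : (R → EReal) → Finset (R → ℝ)) : Prop :=
  ∀ b ∈ signPatterns R, IsIntegralConicalBasis (ED b) (signCone A b)

/-- The set `E^A`: the union of the chosen sets of extreme directions over all sign patterns. -/
def allExtremeDirections {R : Type*} (ED : (R → EReal) → Finset (R → ℝ)) : Set (R → ℝ) :=
  ⋃ b ∈ signPatterns R, (ED b : Set (R → ℝ))

/-- The sum of `p i * b i` over all `i` with `p i ≠ 0` is ill-defined: it has an ill-defined entry
`b i`, or a summand `∞` together with a summand `-∞`. -/
def SumIllDefined {R : Type*} (b : R → Option EReal) (p : R → ℝ) : Prop :=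
  (∃ i, p i ≠ 0 ∧ b i = none) ∨
    ∃ i j, p i ≠ 0 ∧ p j ≠ 0 ∧
      (∃ x, b i = some x ∧ (p i : EReal) * x = ⊤) ∧ (∃ y, b j = some y ∧ (p j : EReal) * y = ⊥)

/-- The property of `p`: the sum of `p i * b i` over all `i` with `p i ≠ 0` is zero or ill-defined.
(The default value `0` is used only where the sum is ill-defined.) -/
def PropertyK {R : Type*} [Fintype R] (b : R → Option EReal) (p : R → ℝ) : Prop :=
  (∑ i with p i ≠ 0, (p i : EReal) * (b i).getD 0) = 0 ∨ SumIllDefined b p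

/-! ### Linear systems with infinite right-hand sides -/

section LinearSystem

open Filter Topology

/-! The proof has two halves, joined by the condition that some real vectors `v n` make `A (v n)`
converge in the extended reals to every well-defined entry of `b`.

This condition is equivalent to consistency (`Assessment.consistent_iff_exists_tendsto`). For `v =
log β` a pair row of `A v` is the log ratio of two path probabilities, which Bayes' rule turns into
a belief ratio. Perfect recall makes the log probability of a history a sum over the set of its
actions. Conversely, exponentials of `v n`, normalized at each information set, give the
approximating strategies.

It is also equivalent to the test (`exists_tendsto_mulVec_iff`). If `p A = 0`, then `∑ p i * (A (v
n)) i = 0` for all `n`, and this passes to the limit unless the limiting sum is ill-defined. For the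
converse a single cone suffices, that of the sign pattern of `b`. Its elements that vanish at the
ill-defined rows also vanish at the infinite rows and are orthogonal to the finite part of `b`. The
Fredholm alternative then gives `y` solving the finite rows, a transposition theorem gives `z` that
is zero on them and strictly of the right sign on the infinite rows, and `y + n z` has the required
limits. -/

lemma EReal.coe_finset_sum {ι : Type*} (s : Finset ι) (f : ι → ℝ) :
    ((∑ i ∈ s, f i : ℝ) : EReal) = ∑ i ∈ s, (f i : EReal) := by
  classical
  induction s using Finset.induction_on with
  | empty => simp
  | insert a s ha ih => rw [Finset.sum_insert ha, Finset.sum_insert ha, EReal.coe_add, ih]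

lemma EReal.sum_ne_bot {ι : Type*} {s : Finset ι} {f : ι → EReal} (h : ∀ i ∈ s, f i ≠ ⊥) :
    ∑ i ∈ s, f i ≠ ⊥ := by
  classical
  induction s using Finset.induction_on with
  | empty => simp
  | insert a s ha ih =>
    rw [Finset.sum_insert ha]
    exact EReal.add_ne_bot_iff.2 ⟨h a (by simp), ih fun i hi => h i (by simp [hi])⟩

lemma EReal.sum_ne_top {ι : Type*} {s : Finset ι} {f : ι → EReal} (h : ∀ i ∈ s, f i ≠ ⊤) :
    ∑ i ∈ s, f i ≠ ⊤ := by
  classical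
  induction s using Finset.induction_on with
  | empty => simp
  | insert a s ha ih =>
    rw [Finset.sum_insert ha]
    exact EReal.add_ne_top (h a (by simp)) (ih fun i hi => h i (by simp [hi]))

/-- Sums of extended reals are continuous where no `⊤` meets a `⊥`. -/
lemma EReal.tendsto_finset_sum {ι α : Type*} {l : Filter α} {s : Finset ι} {f : ι → α → EReal}
    {a : ι → EReal} (h : (∀ i ∈ s, a i ≠ ⊥) ∨ ∀ i ∈ s, a i ≠ ⊤)
    (hf : ∀ i ∈ s, Tendsto (f i) l (𝓝 (a i))) :
    Tendsto (fun x => ∑ i ∈ s, f i x) l (𝓝 (∑ i ∈ s, a i)) := by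
  classical
  induction s using Finset.induction_on with
  | empty => simpa using tendsto_const_nhds
  | insert j s hj ih =>
    simp only [Finset.sum_insert hj]
    have ih' := ih (h.imp (fun h i hi => h i (by simp [hi])) (fun h i hi => h i (by simp [hi])))
      fun i hi => hf i (by simp [hi])
    have hc : ContinuousAt (fun p : EReal × EReal => p.1 + p.2) (a j, ∑ i ∈ s, a i) := by
      rcases h with h | h
      · exact EReal.continuousAt_add (Or.inr (EReal.sum_ne_bot fun i hi => h i (by simp [hi])))
          (Or.inl (h j (by simp)))
      · exact EReal.continuousAt_add (Or.inl (h j (by simp)))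
          (Or.inr (EReal.sum_ne_top fun i hi => h i (by simp [hi])))
    exact hc.tendsto.comp ((hf j (by simp)).prodMk_nhds ih')

lemma EReal.coe_mul_eq_top_or_bot {r : ℝ} (hr : r ≠ 0) {y : EReal} (hy : y = ⊤ ∨ y = ⊥) :
    (r : EReal) * y = ⊤ ∨ (r : EReal) * y = ⊥ := by
  rcases hr.lt_or_gt with h | h <;> rcases hy with rfl | rfl
  · exact Or.inr (EReal.coe_mul_top_of_neg h)
  · exact Or.inl (EReal.coe_mul_bot_of_neg h)
  · exact Or.inl (EReal.coe_mul_top_of_pos h)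
  · exact Or.inr (EReal.coe_mul_bot_of_pos h)

lemma IsIntegralConicalBasis.subset {R : Type*} {S : Finset (R → ℝ)} {K : Set (R → ℝ)}
    (h : IsIntegralConicalBasis S K) {e : R → ℝ} (he : e ∈ S) : e ∈ K := by
  classical
  rw [h.2]
  refine ⟨Pi.single e 1, fun x _ => ?_, ?_⟩
  · rw [Pi.single_apply]; split_ifs <;> norm_num
  · simp [Pi.single_apply, he]

/-! ### Duality for finite systems of linear equations and strict inequalities. -/

variable {R C : Type*} [Fintype R] [Fintype C]

lemma Module.Dual.apply_eq_dotProduct [DecidableEq R] (f : Module.Dual ℝ (R → ℝ)) (y : R → ℝ) :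
    f y = (fun i => f (Pi.single i 1)) ⬝ᵥ y := by
  conv_lhs => rw [pi_eq_sum_univ' y, map_sum]
  simp only [map_smul, smul_eq_mul, dotProduct]
  refine Finset.sum_congr rfl fun i _ => ?_
  rw [mul_comm]

/-- A functional that vanishes on the range of a matrix gives a linear relation of its rows. -/
lemma Matrix.vecMul_eq_zero_of_dotProduct (A : Matrix R C ℝ) {p : R → ℝ}
    (h : ∀ z, p ⬝ᵥ A.mulVec z = 0) : Matrix.vecMul p A = 0 := by
  classical
  ext j
  have := h (Pi.single j 1)
  rw [Matrix.dotProduct_mulVec] at this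
  simpa using this

/-- The coordinate subspace of the vectors that vanish on `F`. -/
def vanishingOn (F : Set R) : Submodule ℝ (R → ℝ) where
  carrier := {y | ∀ i ∈ F, y i = 0}
  zero_mem' := fun _ _ => rfl
  add_mem' := fun ha hb i hi => by simp [ha i hi, hb i hi]
  smul_mem' := fun c y hy i hi => by simp [hy i hi]

/-- The Fredholm alternative for the equations with index in `F`. -/
lemma Matrix.exists_mulVec_eq_on (A : Matrix R C ℝ) (F : Set R) (b : R → ℝ)
    (h : ∀ p : R → ℝ, Matrix.vecMul p A = 0 → (∀ i ∉ F, p i = 0) → p ⬝ᵥ b = 0) :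
    ∃ y, ∀ i ∈ F, A.mulVec y i = b i := by
  classical
  by_cases hb : b ∈ LinearMap.range A.mulVecLin ⊔ vanishingOn F
  · obtain ⟨_, ⟨y, rfl⟩, w, hw, hyw⟩ := Submodule.mem_sup.1 hb
    refine ⟨y, fun i hi => ?_⟩
    rw [← hyw]
    simp [hw i hi]
  · obtain ⟨f, hfb, hf⟩ := Submodule.exists_le_ker_of_notMem hb
    refine absurd ?_ hfb
    rw [Module.Dual.apply_eq_dotProduct f]
    refine h _ (A.vecMul_eq_zero_of_dotProduct fun z => ?_) fun i hi => ?_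
    · rw [← Module.Dual.apply_eq_dotProduct f]
      exact hf (Submodule.mem_sup_left ⟨z, rfl⟩)
    · refine hf (Submodule.mem_sup_right fun j hj => ?_)
      rw [Pi.single_eq_of_ne]
      rintro rfl
      exact hi hj

/-- A transposition theorem: if no admissible relation of the rows is nonzero on the rows with
`σ i ≠ 0`, then the system `A z = 0` on `F`, `σ i * (A z) i > 0` where `σ i ≠ 0` is solvable. -/
lemma Matrix.exists_mulVec_strict (A : Matrix R C ℝ) (F : Set R) (σ : R → ℝ)
    (hσ : ∀ i ∈ F, σ i = 0)
    (h : ∀ p : R → ℝ, Matrix.vecMul p A = 0 → (∀ i ∉ F, 0 ≤ σ i * p i) →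
      (∀ i ∉ F, σ i = 0 → p i = 0) → ∀ i, σ i * p i = 0) :
    ∃ z, (∀ i ∈ F, A.mulVec z i = 0) ∧ ∀ i, σ i ≠ 0 → 0 < σ i * A.mulVec z i := by
  classical
  -- The claim is that the open convex set `O` meets the subspace `D`; otherwise a separating
  -- functional yields a forbidden relation of the rows.
  let O : Set (R → ℝ) := ⋂ i, {y | σ i ≠ 0 → 0 < σ i * y i}
  have hO : ∀ y, y ∈ O ↔ ∀ i, σ i ≠ 0 → 0 < σ i * y i := fun y => by simp [O]
  let D : Submodule ℝ (R → ℝ) := LinearMap.range A.mulVecLin ⊓ vanishingOn F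
  by_cases hd : Disjoint O (D : Set (R → ℝ))
  swap
  · obtain ⟨_, hyO, ⟨z, rfl⟩, hz⟩ := Set.not_disjoint_iff.1 hd
    exact ⟨z, hz, (hO _).1 hyO⟩
  exfalso
  have hconv : Convex ℝ O := by
    refine convex_iInter fun i x hx y hy a b ha hb hab hi => ?_
    have h1 := hx hi
    have h2 := hy hi
    have h3 : σ i * (a • x + b • y) i = a * (σ i * x i) + b * (σ i * y i) := by
      simp only [Pi.add_apply, Pi.smul_apply, smul_eq_mul]; ring
    rw [h3]
    rcases ha.eq_or_lt with rfl | ha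
    · have : b = 1 := by linarith
      subst this
      linarith
    · have := mul_pos ha h1
      have := mul_nonneg hb h2.le
      linarith
  have hopen : IsOpen O := by
    refine isOpen_iInter_of_finite fun i => ?_
    by_cases hi : σ i = 0
    · simp [hi]
    · simp only [ne_eq, hi, not_false_eq_true, true_imp_iff]
      exact isOpen_lt continuous_const (by fun_prop)
  obtain ⟨f, u, hfO, hfD⟩ := geometric_hahn_banach_open hconv hopen D.convex hd
  have hu : u ≤ 0 := by simpa using hfD 0 D.zero_mem
  have hD : ∀ y ∈ D, f y = 0 := by
    intro y hy
    by_contra hne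
    -- A functional bounded below on a subspace vanishes there: the rescaled `y` would have value `u
    -- - 1 < u`.
    have := hfD (((u - 1) / f y) • y) (D.smul_mem _ hy)
    rw [map_smul, smul_eq_mul, div_mul_cancel₀ _ hne] at this
    linarith
  -- `O` is stable under adding nonnegative multiples of such directions, so `f` cannot increase
  -- along them. Where `σ i = 0` both signs of `t` are allowed, which forces `f` to vanish on that
  -- coordinate.
  have hsign : ∀ i (t : ℝ), 0 ≤ t * σ i → t * f (Pi.single i 1) ≤ 0 := by
    intro i t ht
    by_contra! hpos
    have hmem : ∀ r : ℝ, 0 ≤ r → σ + (r * t) • Pi.single i (1 : ℝ) ∈ O := by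
      intro r hr
      rw [hO]
      intro j hj
      have h1 : 0 < σ j * σ j := mul_self_pos.2 hj
      rcases eq_or_ne j i with rfl | hji
      · have := mul_nonneg hr ht
        simp only [Pi.add_apply, Pi.smul_apply, Pi.single_eq_same, smul_eq_mul, mul_one]
        nlinarith
      · simpa [hji] using h1
    -- This step length lifts the value of `f` to `f σ + |f σ| ≥ 0`, although `f < u ≤ 0` on `O`.
    have h1 := hfO _ (hmem (|f σ| / (t * f (Pi.single i 1))) (by positivity))
    rw [map_add, map_smul, smul_eq_mul, mul_assoc, div_mul_cancel₀ _ hpos.ne'] at h1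
    have := neg_abs_le (f σ)
    linarith
  have hneg : f σ < 0 := (hfO σ ((hO σ).2 fun i hi => mul_self_pos.2 hi)).trans_le hu
  have hann : (f : Module.Dual ℝ (R → ℝ)) ∈ D.dualAnnihilator :=
    (Submodule.mem_dualAnnihilator _).2 hD
  rw [show D = LinearMap.range A.mulVecLin ⊓ vanishingOn F from rfl,
    Subspace.dualAnnihilator_inf_eq] at hann
  -- Here `g` annihilates the range of `A`, while `k` is supported on `F`. Hence `-g` is a relation
  -- of the rows that agrees with `-f` off `F`, and `σ` does not see `F`.
  obtain ⟨g, hg, k, hk, hgk⟩ := Submodule.mem_sup.1 hann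
  rw [Submodule.mem_dualAnnihilator] at hg hk
  have hgf : ∀ i ∉ F, g (Pi.single i 1) = f (Pi.single i 1) := by
    intro i hi
    have h1 : k (Pi.single i 1) = 0 := by
      refine hk _ fun j hj => ?_
      rw [Pi.single_eq_of_ne]
      rintro rfl
      exact hi hj
    have h2 := LinearMap.congr_fun hgk (Pi.single i 1)
    simpa [h1] using h2
  have key := h (fun i => -g (Pi.single i 1)) ?_ ?_ ?_
  · have h1 : f σ = ∑ i, f (Pi.single i 1) * σ i :=
      Module.Dual.apply_eq_dotProduct (f : Module.Dual ℝ (R → ℝ)) σ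
    rw [h1, Finset.sum_eq_zero] at hneg
    · exact lt_irrefl _ hneg
    intro i _
    by_cases hi : i ∈ F
    · simp [hσ i hi]
    · have := key i
      rw [hgf i hi] at this
      linarith
  · refine A.vecMul_eq_zero_of_dotProduct fun z => ?_
    have h1 := hg _ ⟨z, rfl⟩
    rw [Module.Dual.apply_eq_dotProduct g] at h1
    have h2 : (fun i => -g (Pi.single i 1)) = -fun i => g (Pi.single i 1) := rfl
    rw [h2, neg_dotProduct, neg_eq_zero]
    exact h1
  · intro i hi
    have := hsign i (σ i) (mul_self_nonneg _)
    rw [hgf i hi]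
    linarith
  · intro i hi h0
    have h1 := hsign i 1 (by simp [h0])
    have h2 := hsign i (-1) (by simp [h0])
    rw [hgf i hi]
    linarith

/-! ### The limit criterion for right-hand sides with infinite or ill-defined entries. -/

/-- The sign pattern of a right-hand side, with `⊤` at the ill-defined entries. -/
noncomputable def rhsPattern (b : Option EReal) : EReal :=
  open Classical in if b = none ∨ b = some ⊤ then ⊤ else if b = some ⊥ then ⊥ else 0

/-- `A v` can be made to converge to `b` if and only if every chosen extreme direction has the
property to be tested. -/
theorem exists_tendsto_mulVec_iff (A : Matrix R C ℝ) (b : R → Option EReal)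
    (ED : (R → EReal) → Finset (R → ℝ)) (hED : IsExtremeDirectionChoice A ED) :
    (∃ v : ℕ → C → ℝ, ∀ i y, b i = some y →
      Tendsto (fun n => (A.mulVec (v n) i : EReal)) atTop (𝓝 y)) ↔
    ∀ p ∈ allExtremeDirections ED, PropertyK b p := by
  classical
  constructor
  · rintro ⟨v, hv⟩ p hp
    simp only [allExtremeDirections, Set.mem_iUnion] at hp
    obtain ⟨c, hc, hp⟩ := hp
    have hpA : Matrix.vecMul p A = 0 := ((hED c hc).subset hp).1
    by_cases hill : SumIllDefined b p
    · exact Or.inr hill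
    refine Or.inl ?_
    unfold SumIllDefined at hill
    push Not at hill
    obtain ⟨hdef, hinf⟩ := hill
    have hsome : ∀ i, p i ≠ 0 → b i = some ((b i).getD 0) := by
      intro i hi
      obtain ⟨y, hy⟩ := Option.ne_none_iff_exists'.1 (hdef i hi)
      simp [hy]
    have hlim : Tendsto (fun n => ∑ i with p i ≠ 0, (p i : EReal) * (A.mulVec (v n) i : EReal))
        atTop (𝓝 (∑ i with p i ≠ 0, (p i : EReal) * (b i).getD 0)) := by
      refine EReal.tendsto_finset_sum ?_ fun i hi => ?_
      · by_contra! hcon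
        obtain ⟨⟨j, hj, hj'⟩, i, hi, hi'⟩ := hcon
        exact hinf i j (Finset.mem_filter.1 hi).2 (Finset.mem_filter.1 hj).2
          ⟨_, hsome i (Finset.mem_filter.1 hi).2, hi'⟩ _
          (hsome j (Finset.mem_filter.1 hj).2) hj'
      · have hpi := (Finset.mem_filter.1 hi).2
        have h1 := hv i _ (hsome i hpi)
        have hpi' : (p i : EReal) ≠ 0 := by exact_mod_cast hpi
        exact (EReal.continuousAt_mul (p := ((p i : EReal), (b i).getD 0)) (Or.inl hpi')
          (Or.inl hpi') (Or.inl (EReal.coe_ne_bot _)) (Or.inl (EReal.coe_ne_top _))).tendsto.comp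
          (tendsto_const_nhds.prodMk_nhds h1)
    have hzero : ∀ n, ∑ i with p i ≠ 0, (p i : EReal) * (A.mulVec (v n) i : EReal) = 0 := by
      intro n
      have h1 : ∑ i with p i ≠ 0, p i * A.mulVec (v n) i = 0 := by
        rw [Finset.sum_filter_of_ne (fun i _ hi => left_ne_zero_of_mul hi)]
        change p ⬝ᵥ A.mulVec (v n) = 0
        rw [Matrix.dotProduct_mulVec, hpA, zero_dotProduct]
      have h2 := congrArg Real.toEReal h1
      rw [EReal.coe_finset_sum] at h2
      simpa only [EReal.coe_mul, EReal.coe_zero] using h2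
    simp only [hzero] at hlim
    exact (tendsto_nhds_unique hlim tendsto_const_nhds)
  · intro hK
    let c : R → EReal := fun i => rhsPattern (b i)
    have hc : c ∈ signPatterns R := by
      intro i
      simp only [c, rhsPattern]
      split_ifs <;> simp
    have hcnone : ∀ i, b i = none → c i = ⊤ := fun i hi => by simp [c, rhsPattern, hi]
    have hctop : ∀ i, b i = some ⊤ → c i = ⊤ := fun i hi => by simp [c, rhsPattern, hi]
    have hcbot : ∀ i, b i = some ⊥ → c i = ⊥ := fun i hi => by simp [c, rhsPattern, hi]
    -- The finite part of `b`; the default `0` at infinite and ill-defined entries meets only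
    -- relations that vanish there.
    let β : R → ℝ := fun i => ((b i).getD 0).toReal
    -- The test on the extreme directions of the pattern `c` that vanish at the ill-defined entries.
    have hE : ∀ e ∈ ED c, (∀ i, b i = none → e i = 0) →
        (∀ i, b i = some ⊤ ∨ b i = some ⊥ → e i = 0) ∧ e ⬝ᵥ β = 0 := by
      intro e he hnone
      obtain ⟨-, hpos, hneg⟩ := (hED c hc).subset he
      -- In the cone of `c` the sign of `e i` matches that of an infinite `b i`, so no summand is
      -- `⊥`. The sum is thus well-defined, and a single summand `⊤` would make it `⊤` instead of
      -- `0`.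
      have hnb : ∀ i, e i ≠ 0 → ∀ y, b i = some y → (e i : EReal) * y ≠ ⊥ := by
        intro i hi y hy
        induction y with
        | bot =>
          rw [EReal.coe_mul_bot_of_neg ((hneg i (hcbot i hy)).lt_of_ne hi)]
          exact bot_ne_top.symm
        | top =>
          rw [EReal.coe_mul_top_of_pos ((hpos i (hctop i hy)).lt_of_ne' hi)]
          exact bot_ne_top.symm
        | coe y => exact_mod_cast EReal.coe_ne_bot (e i * y)
      have hsome : ∀ i, e i ≠ 0 → b i = some ((b i).getD 0) := by
        intro i hi
        obtain ⟨y, hy⟩ := Option.ne_none_iff_exists'.1 fun h => hi (hnone i h)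
        simp [hy]
      have hsum : ∑ i with e i ≠ 0, (e i : EReal) * (b i).getD 0 = 0 := by
        rcases hK e (Set.mem_iUnion₂.2 ⟨c, hc, he⟩) with h | ⟨i, hi, hi'⟩ |
          ⟨-, j, -, hj, -, y, hy, hy'⟩
        · exact h
        · exact absurd (hnone i hi') hi
        · exact absurd hy' (hnb j hj y hy)
      have hinf : ∀ i, b i = some ⊤ ∨ b i = some ⊥ → e i = 0 := by
        intro i hi
        by_contra hne
        have hmem : i ∈ Finset.univ.filter fun i => e i ≠ 0 := by simpa using hne
        have hterm : (e i : EReal) * (b i).getD 0 = ⊤ :=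
          (EReal.coe_mul_eq_top_or_bot hne (by rcases hi with hi | hi <;> simp [hi])).resolve_right
            (hnb i hne _ (hsome i hne))
        rw [← Finset.add_sum_erase _ _ hmem, hterm, EReal.top_add_of_ne_bot] at hsum
        · exact EReal.top_ne_zero hsum
        · refine EReal.sum_ne_bot fun j hj => ?_
          have hj' := (Finset.mem_filter.1 (Finset.mem_of_mem_erase hj)).2
          exact hnb j hj' _ (hsome j hj')
      refine ⟨hinf, ?_⟩
      have h1 : ((∑ i with e i ≠ 0, e i * β i : ℝ) : EReal) = 0 := by
        rw [EReal.coe_finset_sum, ← hsum]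
        refine Finset.sum_congr rfl fun i hi => ?_
        have hi := (Finset.mem_filter.1 hi).2
        rw [EReal.coe_mul, EReal.coe_toReal]
        · intro h
          have := hsome i hi
          rw [h] at this
          exact hi (hinf i (Or.inl this))
        · intro h
          have := hsome i hi
          rw [h] at this
          exact hi (hinf i (Or.inr this))
      rw [Finset.sum_filter_of_ne (fun i _ hi => left_ne_zero_of_mul hi)] at h1
      exact_mod_cast h1
    have hcone : ∀ p ∈ signCone A c, (∀ i, b i = none → p i = 0) →
        (∀ i, b i = some ⊤ ∨ b i = some ⊥ → p i = 0) ∧ p ⬝ᵥ β = 0 := by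
      intro p hp hnone
      rw [(hED c hc).2] at hp
      obtain ⟨w, hw, rfl⟩ := hp
      -- The value `⊤` of `c` at ill-defined entries is used here: all generators are nonnegative
      -- there, so a combination can vanish only if each generator in use does.
      have hzero : ∀ e ∈ ED c, w e ≠ 0 → ∀ i, b i = none → e i = 0 := by
        intro e he hwe i hi
        have h1 := hnone i hi
        rw [Finset.sum_apply, Finset.sum_eq_zero_iff_of_nonneg] at h1
        · exact (mul_eq_zero.1 (h1 e he)).resolve_left hwe
        · intro e' he'
          exact mul_nonneg (hw e' he') (((hED c hc).subset he').2.1 i (hcnone i hi))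
      have hE' : ∀ e ∈ ED c, w e ≠ 0 → _ := fun e he hwe => hE e he (hzero e he hwe)
      constructor
      · intro i hi
        rw [Finset.sum_apply]
        refine Finset.sum_eq_zero fun e he => ?_
        by_cases hwe : w e = 0
        · simp [hwe]
        · simp [(hE' e he hwe).1 i hi]
      · rw [sum_dotProduct]
        refine Finset.sum_eq_zero fun e he => ?_
        by_cases hwe : w e = 0
        · simp [hwe]
        · rw [smul_dotProduct, (hE' e he hwe).2, smul_zero]
    let F : Set R := {i | ∃ r : ℝ, b i = some (r : EReal)}
    have hcases : ∀ i ∉ F, b i = none ∨ b i = some ⊤ ∨ b i = some ⊥ := by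
      intro i hi
      rcases hbi : b i with _ | y
      · exact Or.inl rfl
      · induction y with
        | bot => exact Or.inr (Or.inr rfl)
        | top => exact Or.inr (Or.inl rfl)
        | coe y => exact absurd ⟨y, hbi⟩ hi
    have hcF : ∀ i ∈ F, c i = 0 := by
      rintro i ⟨r, hr⟩
      simp [c, rhsPattern, hr]
    obtain ⟨y, hy⟩ := A.exists_mulVec_eq_on F β fun p hpA hp =>
      (hcone p ⟨hpA, fun i hi => (hp i fun hF => by simp [hcF i hF] at hi).ge,
        fun i hi => (hp i fun hF => by simp [hcF i hF] at hi).le⟩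
        fun i hi => hp i fun ⟨r, hr⟩ => by simp [hr] at hi).2
    let σ : R → ℝ := fun i => if b i = some ⊤ then 1 else if b i = some ⊥ then -1 else 0
    have hσtop : ∀ i, b i = some ⊤ → σ i = 1 := fun i hi => by simp [σ, hi]
    have hσbot : ∀ i, b i = some ⊥ → σ i = -1 := fun i hi => by simp [σ, hi]
    obtain ⟨z, hzF, hz⟩ := A.exists_mulVec_strict F σ (by rintro i ⟨r, hr⟩; simp [σ, hr]) <| by
      intro p hpA hpσ hp0 i
      have hnone : ∀ i, b i = none → p i = 0 := fun i hi =>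
        hp0 i (fun ⟨r, hr⟩ => by simp [hr] at hi) (by simp [σ, hi])
      have hp : p ∈ signCone A c := by
        refine ⟨hpA, fun i hi => ?_, fun i hi => ?_⟩
        · have hF : i ∉ F := fun hF => by simp [hcF i hF] at hi
          rcases hcases i hF with h | h | h
          · exact (hnone i h).ge
          · simpa [hσtop i h] using hpσ i hF
          · simp [hcbot i h] at hi
        · have hF : i ∉ F := fun hF => by simp [hcF i hF] at hi
          rcases hcases i hF with h | h | h
          · exact (hnone i h).le
          · simp [hctop i h] at hi
          · simpa [hσbot i h] using hpσ i hF
      by_cases h1 : b i = some ⊤ ∨ b i = some ⊥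
      · rw [(hcone p hp hnone).1 i h1, mul_zero]
      · push Not at h1
        simp [σ, h1.1, h1.2]
    -- On `F` the term in `z` disappears; on the infinite rows it drives the value to `±∞`; the
    -- ill-defined rows are unconstrained.
    refine ⟨fun n => y + (n : ℝ) • z, fun i t ht => ?_⟩
    simp only [Matrix.mulVec_add, Matrix.mulVec_smul, Pi.add_apply, Pi.smul_apply, smul_eq_mul]
    induction t with
    | bot =>
      have hneg : A.mulVec z i < 0 := by
        have := hz i (by simp [hσbot i ht])
        rw [hσbot i ht] at this
        linarith
      rw [EReal.tendsto_coe_nhds_bot_iff]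
      exact tendsto_atBot_add_const_left _ _
        (tendsto_natCast_atTop_atTop.atTop_mul_const_of_neg hneg)
    | top =>
      have hpos : 0 < A.mulVec z i := by
        have := hz i (by simp [hσtop i ht])
        rwa [hσtop i ht, one_mul] at this
      rw [EReal.tendsto_coe_nhds_top_iff]
      exact tendsto_atTop_add_const_left _ _
        (tendsto_natCast_atTop_atTop.atTop_mul_const hpos)
    | coe r =>
      have hF : i ∈ F := ⟨r, ht⟩
      simp [hy i hF, hzF i hF, β, ht]

end LinearSystem

/-! ### Consistency in terms of the linear system -/

section LogLimits

open Filter Topology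

/-! ### Limits of differences of logarithms. -/

variable {x y : ℕ → ℝ} {a b : ℝ}

/-- The extended logarithm is continuous and finite arguments never give `⊤`, so the only
obstruction is `⊥ - ⊥`, which `hab` excludes. -/
lemma tendsto_log_sub_log (hx : ∀ n, 0 < x n) (hy : ∀ n, 0 < y n)
    (hxa : Tendsto x atTop (𝓝 a)) (hyb : Tendsto y atTop (𝓝 b)) (hab : ¬(a = 0 ∧ b = 0)) :
    Tendsto (fun n => ((Real.log (x n) - Real.log (y n) : ℝ) : EReal)) atTop
      (𝓝 (ENNReal.log (ENNReal.ofReal a) - ENNReal.log (ENNReal.ofReal b))) := by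
  have ha : 0 ≤ a := ge_of_tendsto' hxa fun n => (hx n).le
  have hb : 0 ≤ b := ge_of_tendsto' hyb fun n => (hy n).le
  have key : ∀ {z : ℕ → ℝ} {c : ℝ}, (∀ n, 0 < z n) → Tendsto z atTop (𝓝 c) →
      Tendsto (fun n => (Real.log (z n) : EReal)) atTop (𝓝 (ENNReal.log (ENNReal.ofReal c))) := by
    intro z c hz hzc
    simp only [← fun n => ENNReal.log_ofReal_of_pos (hz n)]
    exact (ENNReal.continuous_log.tendsto _).comp (ENNReal.tendsto_ofReal hzc)
  simp only [sub_eq_add_neg]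
  refine (EReal.continuousAt_add (p := (ENNReal.log (ENNReal.ofReal a),
    -ENNReal.log (ENNReal.ofReal b))) ?_ ?_).tendsto.comp
    ((key hx hxa).prodMk_nhds (continuous_neg.tendsto _ |>.comp (key hy hyb)))
  · exact Or.inl fun h => ENNReal.ofReal_ne_top (ENNReal.log_eq_top_iff.1 h)
  · by_contra! h
    simp only [ENNReal.log_eq_bot_iff, ENNReal.ofReal_eq_zero, EReal.neg_eq_top_iff] at h
    exact hab ⟨le_antisymm h.1 ha, le_antisymm h.2 hb⟩

lemma tendsto_div_of_tendsto_log_sub_log (hx : ∀ n, 0 < x n) (hy : ∀ n, 0 < y n)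
    (ha : 0 ≤ a) (hb : 0 < b)
    (h : Tendsto (fun n => ((Real.log (x n) - Real.log (y n) : ℝ) : EReal)) atTop
      (𝓝 (ENNReal.log (ENNReal.ofReal a) - ENNReal.log (ENNReal.ofReal b)))) :
    Tendsto (fun n => x n / y n) atTop (𝓝 (a / b)) := by
  have hxy : (fun n => x n / y n) = fun n => Real.exp (Real.log (x n) - Real.log (y n)) := by
    ext n
    rw [Real.exp_sub, Real.exp_log (hx n), Real.exp_log (hy n)]
  rw [hxy]
  rw [ENNReal.log_ofReal_of_pos hb] at h
  rcases ha.eq_or_lt with rfl | ha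
  · rw [ENNReal.ofReal_zero, ENNReal.log_zero, EReal.bot_sub, EReal.tendsto_coe_nhds_bot_iff] at h
    rw [zero_div]
    exact Real.tendsto_exp_atBot.comp h
  · rw [ENNReal.log_ofReal_of_pos ha, ← EReal.coe_sub, EReal.tendsto_coe] at h
    have h1 : a / b = Real.exp (Real.log a - Real.log b) := by
      rw [Real.exp_sub, Real.exp_log ha, Real.exp_log hb]
    rw [h1]
    exact (Real.continuous_exp.tendsto _).comp h

end LogLimits

namespace ExtensiveGame

open Filter Topology

/-! ### Paths, information sets and perfect recall. -/

variable {N L Act : Type*} {G : ExtensiveGame N L Act}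

lemma map_finRange_append_singleton {α : Type*} (φ : List Act → Act → α) (g : List Act) (a : Act) :
    (List.finRange (g ++ [a]).length).map
        (fun k : Fin (g ++ [a]).length => φ ((g ++ [a]).take k) ((g ++ [a]).get k)) =
      (List.finRange g.length).map (fun k : Fin g.length => φ (g.take k) (g.get k)) ++ [φ g a] := by
  refine List.ext_getElem (by simp) fun i h1 h2 => ?_
  simp only [List.length_map, List.length_finRange, List.length_append, List.length_singleton]
    at h1
  by_cases hi : i < g.length
  · rw [List.getElem_append_left (by simpa using hi)]
    simp [hi, List.take_append_of_le_length hi.le]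
  · obtain rfl : i = g.length := by omega
    simp

lemma path_nil : G.path [] = [] := rfl

lemma path_append_singleton (g : List Act) (a : Act) :
    G.path (g ++ [a]) = G.path g ++ [(G.info g, a)] :=
  map_finRange_append_singleton (fun g a => (G.info g, a)) g a

lemma mem_path {x : L × Act} {h : List Act} (hx : x ∈ G.path h) :
    ∃ g a, g ++ [a] <+: h ∧ x = (G.info g, a) := by
  induction h using List.reverseRecOn with
  | nil => simp [path_nil] at hx
  | append_singleton h b ih =>
    rw [path_append_singleton, List.mem_append, List.mem_singleton] at hx
    rcases hx with hx | rfl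
    · obtain ⟨g, a, hg, rfl⟩ := ih hx
      exact ⟨g, a, hg.trans (List.prefix_append _ _), rfl⟩
    · exact ⟨h, b, List.prefix_rfl, rfl⟩

open Classical in
lemma length_experience_append_singleton (i : N) (g : List Act) (a : Act) :
    (G.experience i (g ++ [a])).length =
      (G.experience i g).length + if G.player g = i then 1 else 0 := by
  have key : ∀ h : List Act, (G.experience i h).length =
      ((List.finRange h.length).map
        fun k : Fin h.length => G.player (h.take k)).countP (· = i) := by
    intro h
    rw [experience, List.length_map, List.countP_map, List.countP_eq_length_filter]
    rfl
  rw [key, key, map_finRange_append_singleton (fun g _ => G.player g), List.countP_append]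
  simp [List.countP_singleton]

lemma length_experience_mono (i : N) {g h : List Act} (hgh : g <+: h) :
    (G.experience i g).length ≤ (G.experience i h).length := by
  obtain ⟨t, rfl⟩ := hgh
  induction t using List.reverseRecOn with
  | nil => simp
  | append_singleton t a ih =>
    rw [← List.append_assoc, length_experience_append_singleton]
    omega

lemma mem_nonterminal {h : List Act} :
    h ∈ G.nonterminal ↔ ∃ a, h ++ [a] ∈ G.histories := by
  simp only [nonterminal, Finset.mem_filter, and_iff_right_iff_imp]
  rintro ⟨a, ha⟩
  exact G.prefix_mem _ ha _ (List.prefix_append _ _)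

lemma mem_historiesOf {I : L} {h : List Act} :
    h ∈ G.historiesOf I ↔ h ∈ G.nonterminal ∧ G.info h = I := by
  simp [historiesOf]

lemma mem_infoSets {I : L} : I ∈ G.infoSets ↔ ∃ h, h ∈ G.historiesOf I := by
  simp [infoSets, historiesOf]

lemma mem_histories_of_mem_nonterminal {h : List Act} (hh : h ∈ G.nonterminal) :
    h ∈ G.histories := by
  obtain ⟨a, ha⟩ := mem_nonterminal.1 hh
  exact G.prefix_mem _ ha _ (List.prefix_append _ _)

lemma mem_actions {I : L} {a : Act} :
    a ∈ G.actions I ↔ ∃ h ∈ G.historiesOf I, h ++ [a] ∈ G.histories := by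
  simp only [actions, Finset.mem_filter, and_iff_right_iff_imp]
  rintro ⟨h, -, ha⟩
  classical exact Finset.mem_biUnion.2 ⟨_, ha, by simp⟩

lemma mem_actionSet {x : L × Act} :
    x ∈ G.actionSet ↔ x.1 ∈ G.infoSets ∧ x.2 ∈ G.actions x.1 := by
  simp only [actionSet, Finset.mem_filter, Finset.mem_product]
  refine ⟨fun h => ⟨h.1.1, h.2⟩, fun h => ⟨⟨h.1, ?_⟩, h.2⟩⟩
  have h2 := h.2
  simp only [actions, Finset.mem_filter] at h2
  exact h2.1

lemma mem_actionSet_of_append {g : List Act} {a : Act} (h : g ++ [a] ∈ G.histories) :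
    (G.info g, a) ∈ G.actionSet := by
  have hg : g ∈ G.historiesOf (G.info g) := mem_historiesOf.2 ⟨mem_nonterminal.2 ⟨a, h⟩, rfl⟩
  exact mem_actionSet.2 ⟨mem_infoSets.2 ⟨g, hg⟩, mem_actions.2 ⟨g, hg, h⟩⟩

lemma actions_nonempty {I : L} (hI : I ∈ G.infoSets) : (G.actions I).Nonempty := by
  obtain ⟨h, hh⟩ := mem_infoSets.1 hI
  obtain ⟨a, ha⟩ := mem_nonterminal.1 (mem_historiesOf.1 hh).1
  exact ⟨a, mem_actions.2 ⟨h, hh, ha⟩⟩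

lemma mem_actionSet_of_mem_path {h : List Act} (hh : h ∈ G.histories) {x : L × Act}
    (hx : x ∈ G.path h) : x ∈ G.actionSet := by
  obtain ⟨g, a, hg, rfl⟩ := mem_path hx
  exact mem_actionSet_of_append (G.prefix_mem _ hh _ hg)

/-- Under perfect recall, no information set is reached twice. -/
lemma PerfectRecall.info_ne (hG : G.PerfectRecall) {g h : List Act} {a : Act}
    (hh : h ∈ G.nonterminal) (hgh : g ++ [a] <+: h) : G.info g ≠ G.info h := by
  intro hinfo
  have hg : g ∈ G.nonterminal :=
    mem_nonterminal.2 ⟨a, G.prefix_mem _ (mem_histories_of_mem_nonterminal hh) _ hgh⟩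
  have hpl : G.player g = G.player h :=
    G.player_eq _ _ (mem_nonterminal.1 hg) (mem_nonterminal.1 hh) hinfo
  -- Perfect recall gives the acting player equally long experiences at `g` and `h`, yet the move at
  -- `g` lengthens the experience by one.
  have h1 := congrArg List.length (hG g hg h hh hinfo)
  have h2 := length_experience_mono (G := G) (G.player g) hgh
  rw [length_experience_append_singleton, if_pos rfl] at h2
  omega

/-- The matrix records only whether an action lies on a path, so multiplicities must be excluded
before a product along the path can be read as a product over a set. -/
lemma PerfectRecall.nodup_path (hG : G.PerfectRecall) {h : List Act} (hh : h ∈ G.histories) :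
    (G.path h).Nodup := by
  induction h using List.reverseRecOn with
  | nil => simp [path_nil]
  | append_singleton h b ih =>
    rw [path_append_singleton]
    refine List.Nodup.append (ih (G.prefix_mem _ hh _ (List.prefix_append _ _))) (by simp) ?_
    rw [List.disjoint_singleton]
    intro hx
    obtain ⟨g, a, hg, hxg⟩ := mem_path hx
    exact hG.info_ne (mem_nonterminal.2 ⟨b, hh⟩) hg (congrArg Prod.fst hxg).symm

/-! ### Weights of histories and the rows of the system. -/

variable (G) in
/-- The product of the weights of the actions along a history. -/
def weight (w : L → Act → ℝ) (h : List Act) : ℝ :=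
  ((G.path h).map fun x => w x.1 x.2).prod

lemma weight_append_singleton (w : L → Act → ℝ) (h : List Act) (a : Act) :
    G.weight w (h ++ [a]) = G.weight w h * w (G.info h) a := by
  simp [weight, path_append_singleton]

lemma weight_pos {w : L → Act → ℝ} (hw : ∀ x ∈ G.actionSet, 0 < w x.1 x.2) {h : List Act}
    (hh : h ∈ G.histories) : 0 < G.weight w h := by
  refine List.prod_pos fun y hy => ?_
  obtain ⟨x, hx, rfl⟩ := List.mem_map.1 hy
  exact hw x (mem_actionSet_of_mem_path hh hx)

open Classical in
lemma log_weight (hG : G.PerfectRecall) {w : L → Act → ℝ}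
    (hw : ∀ x ∈ G.actionSet, 0 < w x.1 x.2) {h : List Act} (hh : h ∈ G.histories) :
    Real.log (G.weight w h) =
      ∑ x : G.Col, if x.1 ∈ G.path h then Real.log (w x.1.1 x.1.2) else 0 := by
  have hsub : (G.path h).toFinset ⊆ G.actionSet := fun x hx =>
    mem_actionSet_of_mem_path hh (List.mem_toFinset.1 hx)
  rw [weight, ← List.prod_toFinset _ (hG.nodup_path hh),
    Real.log_prod fun x hx => (hw x (hsub hx)).ne',
    Finset.sum_coe_sort G.actionSet
      (fun x => if x ∈ G.path h then Real.log (w x.1 x.2) else 0), ← Finset.sum_filter]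
  refine Finset.sum_congr ?_ fun _ _ => rfl
  ext x
  simp only [List.mem_toFinset, Finset.mem_filter]
  exact ⟨fun hx => ⟨hsub (List.mem_toFinset.2 hx), hx⟩, fun hx => hx.2⟩

open Classical in
lemma systemMatrix_mulVec_inr (v : G.Col → ℝ) (x : G.Col) :
    G.systemMatrix.mulVec v (Sum.inr x) = v x := by
  rw [systemMatrix, Matrix.fromRows_mulVec, Sum.elim_inr, Matrix.one_mulVec]

lemma mem_pairSet {q : List Act × List Act} :
    q ∈ G.pairSet ↔ q.1 ∈ G.nonterminal ∧ q.2 ∈ G.nonterminal ∧ G.info q.1 = G.info q.2 := by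
  simp [pairSet, and_assoc]

/-- Actions common to both paths cancel in the difference of the two log sums, which matches the
zero entries of the matrix. -/
lemma systemMatrix_mulVec_inl (hG : G.PerfectRecall) {w : L → Act → ℝ}
    (hw : ∀ x ∈ G.actionSet, 0 < w x.1 x.2) (q : {q // q ∈ G.pairSet}) :
    G.systemMatrix.mulVec (fun x => Real.log (w x.1.1 x.1.2)) (Sum.inl q) =
      Real.log (G.weight w q.1.1) - Real.log (G.weight w q.1.2) := by
  classical
  obtain ⟨h1, h2, -⟩ := mem_pairSet.1 q.2
  rw [systemMatrix, Matrix.fromRows_mulVec, Sum.elim_inl,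
    log_weight hG hw (mem_histories_of_mem_nonterminal h1),
    log_weight hG hw (mem_histories_of_mem_nonterminal h2), ← Finset.sum_sub_distrib]
  refine Finset.sum_congr rfl fun x _ => ?_
  simp only [pairMatrix]
  by_cases hx1 : x.1 ∈ G.path q.1.1 <;> by_cases hx2 : x.1 ∈ G.path q.1.2 <;> simp [hx1, hx2]

lemma sum_weight_pos {w : L → Act → ℝ} (hw : ∀ x ∈ G.actionSet, 0 < w x.1 x.2) {I : L}
    (hI : I ∈ G.infoSets) : 0 < ∑ h ∈ G.historiesOf I, G.weight w h :=
  Finset.sum_pos (fun _ hh =>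
    weight_pos hw (mem_histories_of_mem_nonterminal (mem_historiesOf.1 hh).1)) (mem_infoSets.1 hI)

/-- The assessment of a completely mixed strategy profile, with beliefs given by Bayes' rule. -/
noncomputable def bayesAssessment (w : L → Act → ℝ) (hw : ∀ x ∈ G.actionSet, 0 < w x.1 x.2)
    (hsum : ∀ I ∈ G.infoSets, ∑ a ∈ G.actions I, w I a = 1) : G.Assessment where
  strategy := w
  belief I h := G.weight w h / ∑ g ∈ G.historiesOf I, G.weight w g
  strategy_nonneg I hI a ha := (hw (I, a) (mem_actionSet.2 ⟨hI, ha⟩)).le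
  strategy_sum := hsum
  belief_nonneg I hI h hh := div_nonneg
    (weight_pos hw (mem_histories_of_mem_nonterminal (mem_historiesOf.1 hh).1)).le
    (sum_weight_pos hw hI).le
  belief_sum I hI := by rw [← Finset.sum_div, div_self (sum_weight_pos hw hI).ne']

lemma Assessment.rhs_eq_some_iff {s : G.Assessment} {i : G.Row} {y : EReal} :
    s.rhs i = some y ↔ ¬(s.alpha i = 0 ∧ s.gamma i = 0) ∧
      ENNReal.log (ENNReal.ofReal (s.alpha i)) - ENNReal.log (ENNReal.ofReal (s.gamma i)) = y := by
  unfold rhs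
  split_ifs with h <;> simp [h]

/-- Every available action ends some history, so its probability is a factor of a positive product.
-/
lemma Assessment.strategy_pos {s : G.Assessment} (hs : ∀ h ∈ G.histories, 0 < s.prob h) :
    ∀ x ∈ G.actionSet, 0 < s.strategy x.1 x.2 := by
  rintro ⟨I, a⟩ hx
  obtain ⟨hI, ha⟩ := mem_actionSet.1 hx
  obtain ⟨h, hh, hha⟩ := mem_actions.1 ha
  refine (s.strategy_nonneg I hI a ha).lt_of_ne' ?_
  have h1 : s.prob (h ++ [a]) = s.prob h * s.strategy (G.info h) a :=
    weight_append_singleton _ _ _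
  rw [(mem_historiesOf.1 hh).2] at h1
  exact right_ne_zero_of_mul (h1 ▸ (hs _ hha).ne')

/-- An assessment is consistent if and only if its linear system is solvable in the limit. -/
theorem Assessment.consistent_iff_exists_tendsto (hG : G.PerfectRecall) (s : G.Assessment) :
    s.Consistent ↔ ∃ v : ℕ → G.Col → ℝ, ∀ i y, s.rhs i = some y →
      Tendsto (fun n => (G.systemMatrix.mulVec (v n) i : EReal)) atTop (𝓝 y) := by
  constructor
  · rintro ⟨t, hβ, hμ, ht⟩
    have hpos : ∀ n, ∀ x ∈ G.actionSet, 0 < (t n).strategy x.1 x.2 :=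
      fun n => Assessment.strategy_pos (ht n).1
    refine ⟨fun n x => Real.log ((t n).strategy x.1.1 x.1.2), fun i y hy => ?_⟩
    obtain ⟨hdef, rfl⟩ := rhs_eq_some_iff.1 hy
    rcases i with q | x
    · obtain ⟨h1, h2, hinfo⟩ := mem_pairSet.1 q.2
      have hq1 : q.1.1 ∈ G.historiesOf (G.info q.1.1) := mem_historiesOf.2 ⟨h1, rfl⟩
      have hq2 : q.1.2 ∈ G.historiesOf (G.info q.1.1) := mem_historiesOf.2 ⟨h2, hinfo.symm⟩
      have hI : G.info q.1.1 ∈ G.infoSets := mem_infoSets.2 ⟨_, hq1⟩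
      have hP : ∀ n, 0 < (t n).probInfo (G.info q.1.1) := fun n => sum_weight_pos (hpos n) hI
      have hb : ∀ n, ∀ h ∈ G.historiesOf (G.info q.1.1),
          0 < (t n).belief (G.info q.1.1) h := fun n h hh => by
        rw [(ht n).2 _ hI h hh]
        exact div_pos ((ht n).1 h (mem_histories_of_mem_nonterminal (mem_historiesOf.1 hh).1))
          (hP n)
      have hgamma : s.gamma (Sum.inl q) = s.belief (G.info q.1.1) q.1.2 := by
        simp [gamma, hinfo]
      rw [hgamma] at hdef ⊢
      have key := tendsto_log_sub_log (fun n => hb n _ hq1) (fun n => hb n _ hq2)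
        (hμ _ hI _ hq1) (hμ _ hI _ hq2) hdef
      refine key.congr fun n => ?_
      -- Both beliefs have the denominator `P(I)`, which cancels in the difference of logarithms.
      rw [systemMatrix_mulVec_inl hG (hpos n), (ht n).2 _ hI _ hq1, (ht n).2 _ hI _ hq2,
        Real.log_div ((ht n).1 _ (mem_histories_of_mem_nonterminal h1)).ne' (hP n).ne',
        Real.log_div ((ht n).1 _ (mem_histories_of_mem_nonterminal h2)).ne' (hP n).ne',
        sub_sub_sub_cancel_right]
      rfl
    · obtain ⟨hI, ha⟩ := mem_actionSet.1 x.2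
      have key := tendsto_log_sub_log (y := fun _ => 1) (fun n => hpos n _ x.2)
        (fun _ => one_pos) (hβ _ hI _ ha) tendsto_const_nhds hdef
      refine key.congr fun n => ?_
      rw [systemMatrix_mulVec_inr, Real.log_one, sub_zero]
  · rintro ⟨v, hv⟩
    classical
    let u : ℕ → L → Act → ℝ := fun n I a =>
      if hx : (I, a) ∈ G.actionSet then Real.exp (v n ⟨(I, a), hx⟩) else 0
    have hu : ∀ n (x : G.Col), u n x.1.1 x.1.2 = Real.exp (v n x) := fun n x => by
      simp only [u, dif_pos x.2]
    -- The system holds only in the limit, so the exponentials need not sum to one; their sums do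
    -- tend to one.
    let Z : ℕ → L → ℝ := fun n I => ∑ a ∈ G.actions I, u n I a
    have hZ : ∀ n, ∀ I ∈ G.infoSets, 0 < Z n I := fun n I hI =>
      Finset.sum_pos (fun a ha => by
        rw [hu n ⟨(I, a), mem_actionSet.2 ⟨hI, ha⟩⟩]; exact Real.exp_pos _) (actions_nonempty hI)
    let w : ℕ → L → Act → ℝ := fun n I a => u n I a / Z n I
    have hw : ∀ n, ∀ x ∈ G.actionSet, 0 < w n x.1 x.2 := fun n x hx =>
      div_pos (by rw [hu n ⟨x, hx⟩]; exact Real.exp_pos _) (hZ n _ (mem_actionSet.1 hx).1)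
    have hwsum : ∀ n, ∀ I ∈ G.infoSets, ∑ a ∈ G.actions I, w n I a = 1 := fun n I hI => by
      rw [← Finset.sum_div, div_self (hZ n I hI).ne']
    have hulim : ∀ I ∈ G.infoSets, ∀ a ∈ G.actions I,
        Tendsto (fun n => u n I a) atTop (𝓝 (s.strategy I a)) := by
      intro I hI a ha
      have hx : (I, a) ∈ G.actionSet := mem_actionSet.2 ⟨hI, ha⟩
      have hg : s.gamma (Sum.inr ⟨(I, a), hx⟩) = 1 := rfl
      have h1 := hv (Sum.inr ⟨(I, a), hx⟩) _
        (rhs_eq_some_iff.2 ⟨fun h => one_ne_zero (hg.symm.trans h.2), rfl⟩)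
      have ha' : s.alpha (Sum.inr ⟨(I, a), hx⟩) = s.strategy I a := rfl
      rw [ha', hg] at h1
      have hua : ∀ n, u n I a = Real.exp (v n ⟨(I, a), hx⟩) := fun n => hu n ⟨(I, a), hx⟩
      have h2 := tendsto_div_of_tendsto_log_sub_log (x := fun n => u n I a) (y := fun _ => 1)
        (fun n => by simp only [hua, Real.exp_pos]) (fun _ => one_pos)
        (s.strategy_nonneg I hI a ha) one_pos (h1.congr fun n => by
          rw [systemMatrix_mulVec_inr]; simp only [hua, Real.log_exp, Real.log_one, sub_zero])
      simpa using h2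
    have hZlim : ∀ I ∈ G.infoSets, Tendsto (fun n => Z n I) atTop (𝓝 1) := fun I hI => by
      rw [← s.strategy_sum I hI]
      exact tendsto_finsetSum _ fun a ha => hulim I hI a ha
    -- Normalizing the strategies does not change the limit of the system.
    have hlog : ∀ i y, s.rhs i = some y → Tendsto (fun n =>
        (G.systemMatrix.mulVec (fun x => Real.log (w n x.1.1 x.1.2)) i : EReal))
        atTop (𝓝 y) := by
      intro i y hy
      have h1 : Tendsto (fun n => fun x : G.Col => -Real.log (Z n x.1.1)) atTop (𝓝 0) := by
        refine tendsto_pi_nhds.2 fun x => ?_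
        have := ((Real.continuousAt_log one_ne_zero).tendsto.comp
          (hZlim _ (mem_actionSet.1 x.2).1)).neg
        simpa using this
      have hcont : Continuous fun z : G.Col → ℝ => G.systemMatrix.mulVec z i :=
        (continuous_apply i).comp (Continuous.matrix_mulVec continuous_const continuous_id)
      have h2 := (hcont.tendsto 0).comp h1
      rw [Matrix.mulVec_zero, Pi.zero_apply] at h2
      have h3 := (EReal.continuousAt_add (p := (y, ((0 : ℝ) : EReal)))
        (Or.inr (EReal.coe_ne_bot _)) (Or.inr (EReal.coe_ne_top _))).tendsto.comp
        ((hv i y hy).prodMk_nhds (EReal.tendsto_coe.2 h2))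
      simp only [EReal.coe_zero, add_zero] at h3
      refine h3.congr fun n => ?_
      simp only [Function.comp_apply]
      rw [← EReal.coe_add, ← Pi.add_apply, ← Matrix.mulVec_add]
      congr 3
      ext x
      simp only [Pi.add_apply, w]
      rw [Real.log_div (by rw [hu]; exact (Real.exp_pos _).ne')
        (hZ n _ (mem_actionSet.1 x.2).1).ne', hu, Real.log_exp, sub_eq_add_neg]
    refine ⟨fun n => bayesAssessment (w n) (hw n) (hwsum n), fun I hI a ha => ?_,
      fun I hI h hh => ?_, fun n => ⟨fun h hh => weight_pos (hw n) hh, fun I hI h hh => rfl⟩⟩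
    · have h1 := (hulim I hI a ha).div (hZlim I hI) one_ne_zero
      rw [div_one] at h1
      exact h1
    -- Some history `g` has positive belief, so every pair row against `g` is well-defined. The
    -- limits of the ratios to `g` then determine all beliefs, since Bayes' rule depends on the
    -- weights only up to a common factor.
    · obtain ⟨g, hg, hgne⟩ := Finset.exists_ne_zero_of_sum_ne_zero
        (ne_of_eq_of_ne (s.belief_sum I hI) one_ne_zero)
      have hgpos := (s.belief_nonneg I hI g hg).lt_of_ne' hgne
      have hwpos : ∀ n, ∀ k ∈ G.historiesOf I, 0 < G.weight (w n) k := fun n k hk =>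
        weight_pos (hw n) (mem_histories_of_mem_nonterminal (mem_historiesOf.1 hk).1)
      have hratio : ∀ k ∈ G.historiesOf I, Tendsto (fun n => G.weight (w n) k / G.weight (w n) g)
          atTop (𝓝 (s.belief I k / s.belief I g)) := by
        intro k hk
        obtain ⟨hk1, hk2⟩ := mem_historiesOf.1 hk
        obtain ⟨hg1, hg2⟩ := mem_historiesOf.1 hg
        have hq : (k, g) ∈ G.pairSet := mem_pairSet.2 ⟨hk1, hg1, hk2.trans hg2.symm⟩
        have halpha : s.alpha (Sum.inl ⟨(k, g), hq⟩) = s.belief I k := by simp [alpha, hk2]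
        have hgamma : s.gamma (Sum.inl ⟨(k, g), hq⟩) = s.belief I g := by simp [gamma, hg2]
        have h1 := hlog (Sum.inl ⟨(k, g), hq⟩) _
          (rhs_eq_some_iff.2 ⟨fun h => hgne (hgamma ▸ h.2), rfl⟩)
        rw [halpha, hgamma] at h1
        refine tendsto_div_of_tendsto_log_sub_log (fun n => hwpos n k hk) (fun n => hwpos n g hg)
          (s.belief_nonneg I hI k hk) hgpos (h1.congr fun n => ?_)
        rw [systemMatrix_mulVec_inl hG (hw n)]
      have hden := tendsto_finsetSum (G.historiesOf I) hratio
      rw [← Finset.sum_div, s.belief_sum I hI] at hden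
      have hlim := (hratio h hh).div hden (by positivity)
      rw [div_div_div_cancel_right₀ hgne, div_one] at hlim
      refine hlim.congr fun n => ?_
      simp only [Pi.div_apply]
      rw [← Finset.sum_div, div_div_div_cancel_right₀ (hwpos n g hg).ne']
      rfl

end ExtensiveGame

/-- The first equivalence concerns the full system of the game, in which an ill-defined entry of the
right-hand side counts as an ill-defined term; the second one concerns the reduced system, from which
the equations with an ill-defined right-hand side are omitted. -/
theorem mainTheorem4 {N L Act : Type*} (G : ExtensiveGame N L Act) (hG : G.PerfectRecall)
    (ED : (G.Row → EReal) → Finset (G.Row → ℝ))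
    (hED : IsExtremeDirectionChoice G.systemMatrix ED)
    (s : G.Assessment) :
    (s.Consistent ↔ ∀ p ∈ allExtremeDirections ED, PropertyK s.rhs p) ∧
    ∀ ED' : (s.ReducedRow → EReal) → Finset (s.ReducedRow → ℝ),
      IsExtremeDirectionChoice s.reducedMatrix ED' →
        (s.Consistent ↔ ∀ p ∈ allExtremeDirections ED', PropertyK s.reducedRhs p) := by
  refine ⟨(s.consistent_iff_exists_tendsto hG).trans (exists_tendsto_mulVec_iff _ _ ED hED),
    fun ED' hED' => (s.consistent_iff_exists_tendsto hG).trans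
      (Iff.trans ?_ (exists_tendsto_mulVec_iff _ _ ED' hED'))⟩
  -- The limit condition concerns only rows with a well-defined right-hand side, so omitting the
  -- others leaves it unchanged, with the same `v`.
  refine exists_congr fun v => ⟨fun h i y hy => h i.1 y hy, fun h i y hy => ?_⟩
  have hi : i ∈ s.wellDefinedRows := by
    classical
    exact Finset.mem_filter.2 ⟨Finset.mem_univ i, by rw [hy]; exact Option.some_ne_none y⟩
  exact h ⟨i, hi⟩ y hy
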